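/- Let $D\in\mathbb N$, $\alpha_1,\dots,\alpha_{D+1}>0$, $\lambda_1,\dots,\lambda_{D+1}\ge 0$, $\alpha^+=\sum_{i=1}^{D+1}\alpha_i$. Definitions. $\chi^2_g$ ($g>0$ real) is the Gamma distribution with shape $g/2$ and rate $1/2$; $\chi'^2_g(\lambda)$ is the law of $Y'$ when $M\sim\mathrm{Poisson}(\lambda/2)$ and $Y'\mid M\sim\chi^2_{g+2M}$. The conditional law of a random element $X$ given $S=s$, for a real random variable $S$, is the weak limit, as $\varepsilon\downarrow0$, of the laws of $X$ conditioned on the event $|S-s|<\varepsilon$. The Conditional Non-central Dirichlet distribution $\mathrm{CNcDir}^D(\underline\alpha,\underline\lambda)$ is the conditional law of $\left(\frac{Y'_1}{Y'^+},\dots,\frac{Y'_D}{Y'^+}\right)$ given $Y'^+=1$, where $Y'_i\sim\chi'^2_{2\alpha_i}(\lambda_i)$, $i=1,\dots,D+1$, are independent and $Y'^+=\sum_{i=1}^{D+1}Y'_i$. The Mixture Weight distribution $\mathrm{MW}^{D+1}(\alpha^+,\underline\lambda)$ is the conditional law of $\underline M=(M_1,\dots,M_{D+1})$ given $Y'^+=1$,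 where the $M_i\sim\mathrm{Poisson}(\lambda_i/2)$ are independent and, given $\underline M$, the $Y'_i\sim\chi^2_{2\alpha_i+2M_i}$ are independent; it depends on $\underline\alpha$ only through $\alpha^+$. Proposition. Let $\underline N=(N_1,\dots,N_{D+1})\sim\mathrm{MW}^{D+1}(\alpha^+,\underline\lambda)$ and let $Z'_1,\dots,Z'_{D+1}$ be real random variables on the same probability space which, conditionally on $\underline N$, are independent with $Z'_i\mid\underline N\sim\chi^2_{2\alpha_i+2N_i}$. Put $Z'^+=\sum_{i=1}^{D+1}Z'_i$. Then: (i) $\left(\frac{Z'_1}{Z'^+},\dots,\frac{Z'_D}{Z'^+}\right)\sim\mathrm{CNcDir}^D(\underline\alpha,\underline\lambda)$; (ii) possibly after extending the probability space (with $\underline N$ and the $Z'_i$ carried over to the extension), there are random variables $Z_i\sim\chi^2_{2\alpha_i}$ ($1\le i\le D+1$) and $F_{i,j}\sim\chi^2_2$ ($1\le i\le D+1$, $j\ge1$) such that all the $Z_i$, all the $F_{i,j}$ and the vector $\underline N$ are mutually independent and, almost surely, $$Z'_i=Z_i+\sum_{j=1}^{N_i}F_{i,j}\qquad\text{for every } i=1,\dots,D+1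 .$$ -/

import Mathlib

open MeasureTheory ProbabilityTheory Filter Topology
open scoped NNReal ENNReal BoundedContinuousFunction

universe u

noncomputable section

/-- `IsCondLawAt P X S s ν`: the probability measure `ν` is the conditional law of `X` given the
(possibly null) event `S = s` under `P`, i.e. the weak limit, as `ε ↓ 0`, of the elementary
conditional laws of `X` given `|S - s| < ε`. If the latter event is null, the elementary
conditional law is the zero measure, so that no `ν` qualifies. -/
def IsCondLawAt {Ω E : Type*} [MeasurableSpace Ω] [MeasurableSpace E] [TopologicalSpace E]
    (P : Measure Ω) (X : Ω → E) (S : Ω → ℝ) (s : ℝ) (ν : Measure E) : Prop :=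
  IsProbabilityMeasure ν ∧
    ∀ f : E →ᵇ ℝ, Tendsto
      (fun ε : ℝ => ∫ x, f x ∂((ProbabilityTheory.cond P (S ⁻¹' Metric.ball s ε)).map X))
      (𝓝[>] 0) (𝓝 (∫ x, f x ∂ν))

/-- The conditional law given `S = s` is unique. -/
theorem IsCondLawAt.unique {Ω E : Type*} [MeasurableSpace Ω] [MeasurableSpace E]
    [TopologicalSpace E] [HasOuterApproxClosed E] [BorelSpace E] {P : Measure Ω} {X : Ω → E}
    {S : Ω → ℝ} {s : ℝ} {ν ν' : Measure E} (h : IsCondLawAt P X S s ν)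
    (h' : IsCondLawAt P X S s ν') : ν = ν' := by
  have := h.1
  have := h'.1
  exact ext_of_forall_integral_eq_of_IsFiniteMeasure
    fun f => tendsto_nhds_unique (h.2 f) (h'.2 f)

/-- The chi-squared distribution with `g` degrees of freedom (`g > 0` real), that is the gamma
distribution with shape `g / 2` and rate `1 / 2`. -/
def chiSq (g : ℝ) : Measure ℝ := gammaMeasure (g / 2) (1 / 2)

theorem isProbabilityMeasure_chiSq {g : ℝ} (hg : 0 < g) : IsProbabilityMeasure (chiSq g) :=
  isProbabilityMeasure_gammaMeasure (half_pos hg) (by norm_num)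

/-- The non-central chi-squared distribution with `g` degrees of freedom and non-centrality
parameter `l`: the law of `Y'` when `M ∼ Poisson(l / 2)` and `Y' ∣ M ∼ χ²_{g + 2M}`. -/
def ncChiSq (g : ℝ) (l : ℝ≥0) : Measure ℝ :=
  (poissonMeasure (l / 2)).bind fun m => chiSq (g + 2 * (m : ℝ))

/-- The kernel sending `n = (n₁, …, n_{D+1})` to the joint law of independent random variables
with distributions `χ²_{2αᵢ + 2nᵢ}`. -/
def chiSqKernel {D : ℕ} (α : Fin (D + 1) → ℝ) :
    Kernel (Fin (D + 1) → ℕ) (Fin (D + 1) → ℝ) :=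
  Kernel.ofFunOfCountable fun n => Measure.pi fun i => chiSq (2 * α i + 2 * (n i : ℝ))

theorem isMarkovKernel_chiSqKernel {D : ℕ} {α : Fin (D + 1) → ℝ} (hα : ∀ i, 0 < α i) :
    IsMarkovKernel (chiSqKernel α) := by
  refine ⟨fun n => ?_⟩
  have : ∀ i, IsProbabilityMeasure (chiSq (2 * α i + 2 * (n i : ℝ))) := fun i =>
    isProbabilityMeasure_chiSq (by have := hα i; positivity)
  exact inferInstanceAs
    (IsProbabilityMeasure (Measure.pi fun i => chiSq (2 * α i + 2 * (n i : ℝ))))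

/-- The joint law of `(M, Y')`, where the `Mᵢ ∼ Poisson(λᵢ / 2)` are independent and, given `M`,
the `Y'ᵢ ∼ χ²_{2αᵢ + 2Mᵢ}` are independent. -/
def poissonChiSq {D : ℕ} (α : Fin (D + 1) → ℝ) (lam : Fin (D + 1) → ℝ≥0) :
    Measure ((Fin (D + 1) → ℕ) × (Fin (D + 1) → ℝ)) :=
  (Measure.pi fun i => poissonMeasure (lam i / 2)).compProd (chiSqKernel α)

/-- The vector `(y₁ / y⁺, …, y_D / y⁺)`, with `y⁺ = y₁ + ⋯ + y_{D+1}`. -/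
def normalized {D : ℕ} (y : Fin (D + 1) → ℝ) : Fin D → ℝ :=
  fun i => y i.castSucc / ∑ k, y k

/-- `ν` is the Conditional Non-central Dirichlet distribution `CNcDir^D(α, λ)`: the conditional
law of `(Y'₁ / Y'⁺, …, Y'_D / Y'⁺)` given `Y'⁺ = 1`, for independent `Y'ᵢ ∼ χ'²_{2αᵢ}(λᵢ)`. -/
def IsCNcDir {D : ℕ} (α : Fin (D + 1) → ℝ) (lam : Fin (D + 1) → ℝ≥0)
    (ν : Measure (Fin D → ℝ)) : Prop :=
  IsCondLawAt (Measure.pi fun i => ncChiSq (2 * α i) (lam i)) normalized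
    (fun y => ∑ k, y k) 1 ν

/-- `ν` is the Mixture Weight distribution `MW^{D+1}(a, λ)`: for some positive `α₁, …, α_{D+1}`
with sum `a`, it is the conditional law of `M` given `Y'⁺ = 1`, where the `Mᵢ ∼ Poisson(λᵢ / 2)`
are independent and, given `M`, the `Y'ᵢ ∼ χ²_{2αᵢ + 2Mᵢ}` are independent. -/
def IsMixtureWeight {D : ℕ} (a : ℝ) (lam : Fin (D + 1) → ℝ≥0)
    (ν : Measure (Fin (D + 1) → ℕ)) : Prop :=
  ∃ α : Fin (D + 1) → ℝ, (∀ i, 0 < α i) ∧ ∑ i, α i = a ∧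
    IsCondLawAt (poissonChiSq α lam) Prod.fst (fun p => ∑ k, p.2 k) 1 ν

end

/-! Independent gamma variables with a common rate have a total that is independent of their
proportions. For shapes `α i + n i`, the total depends on `n` and `α` only through their sums. Hence
conditioning the Poisson mixture on an event about the total leaves the law of the proportions given
`M = n` unchanged and only reweights `M` (`map_cond_comp`). Letting the window around 1 shrink turns
the reweighted law of `M` into the mixture weight law, which gives (i).

The independence comes from exponential tilting: tilting a product of gamma laws by the total is, up
to a constant, a dilation, and dilations fix events about proportions. So the moment generating
function of the total restricted to such an event factors (`map_sum_restrict_pi_gammaMeasure`).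

For (ii), the decomposition holds by construction in a model made of `N` and independent chi-squared
variables, where the sums have the conditional law of `Z'` (`map_prod_blockSum`). Only the joint law
of `(N, Z')` matters: drawing a model point from its conditional law given `(N, Z')` extends the
original space (`exists_kernel_lift`). -/

/-- Two finite measures on `ℝ` whose moment generating functions are finite and agree near `0`
are equal. -/
theorem measure_ext_of_mgf_eventuallyEq {μ ν : Measure ℝ} [IsFiniteMeasure μ] [IsFiniteMeasure ν]
    (hμ : 0 ∈ interior (integrableExpSet id μ)) (hν : 0 ∈ interior (integrableExpSet id ν))
    (h : ∀ᶠ t in 𝓝 0, mgf id μ t = mgf id ν t) : μ = ν := by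
  set U : Set ℝ := interior (integrableExpSet id μ) ∩ interior (integrableExpSet id ν)
  have hconv : Convex ℝ U :=
    convex_integrableExpSet.interior.inter convex_integrableExpSet.interior
  have hU : IsPreconnected {z : ℂ | z.re ∈ U} :=
    (hconv.linear_preimage Complex.reLm).isPreconnected
  -- Both functions are analytic on a vertical strip around the imaginary axis. Agreement at real
  -- points accumulating at 0 spreads to the strip, and on the imaginary axis it is equality of
  -- characteristic functions.
  have key : Set.EqOn (complexMGF id μ) (complexMGF id ν) {z : ℂ | z.re ∈ U} := by
    refine AnalyticOnNhd.eqOn_of_preconnected_of_frequently_eq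
      (analyticOnNhd_complexMGF.mono fun z hz => hz.1)
      (analyticOnNhd_complexMGF.mono fun z hz => hz.2) hU (z₀ := ((0 : ℝ) : ℂ))
      (by simpa using ⟨hμ, hν⟩) ?_
    have hreal : ∃ᶠ x : ℝ in 𝓝[≠] 0, complexMGF id μ x = complexMGF id ν x := by
      refine Eventually.frequently ?_
      filter_upwards [nhdsWithin_le_nhds h] with x hx
      rw [complexMGF_ofReal, complexMGF_ofReal, hx]
    refine Tendsto.frequently (f := fun x : ℝ => (x : ℂ)) ?_ hreal
    refine tendsto_nhdsWithin_iff.2 ⟨?_, ?_⟩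
    · exact (Complex.continuous_ofReal.tendsto 0).mono_left nhdsWithin_le_nhds
    · filter_upwards [self_mem_nhdsWithin] with x hx
      simpa using hx
  refine Measure.ext_of_charFun ?_
  ext t
  rw [← complexMGF_id_mul_I, ← complexMGF_id_mul_I]
  exact key (by simpa using ⟨hμ, hν⟩)

/-! ### Scaling and tilting of gamma laws; densities on product measures -/

theorem measurable_gammaPDF (a r : ℝ) : Measurable (gammaPDF a r) :=
  (measurable_gammaPDFReal a r).ennreal_ofReal

theorem gammaPDFReal_mul {a r c : ℝ} (hr : 0 < r) (hc : 0 < c) (x : ℝ) :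
    gammaPDFReal a (r / c) (c * x) * c = gammaPDFReal a r x := by
  unfold gammaPDFReal
  by_cases hx : 0 ≤ x
  · rw [if_pos hx, if_pos (by positivity), Real.div_rpow hr.le hc.le, Real.mul_rpow hc.le hx,
      Real.rpow_sub_one hc.ne']
    have h1 : r / c * (c * x) = r * x := by field_simp
    have h2 : c ^ a ≠ 0 := (Real.rpow_pos_of_pos hc a).ne'
    rw [h1]
    field_simp
  · rw [if_neg hx, if_neg (by rwa [mul_nonneg_iff_of_pos_left hc]), zero_mul]

theorem map_mul_gammaMeasure {a r c : ℝ} (hr : 0 < r) (hc : 0 < c) :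
    (gammaMeasure a r).map (fun x => c * x) = gammaMeasure a (r / c) := by
  ext s hs
  have hm : Measurable fun x : ℝ => c * x := measurable_const_mul c
  rw [Measure.map_apply hm hs, gammaMeasure, gammaMeasure, withDensity_apply _ (hm hs),
    withDensity_apply _ hs]
  have hv : (volume : Measure ℝ) = ENNReal.ofReal c • (volume.map fun x : ℝ => c * x) := by
    have := Real.smul_map_volume_mul_left hc.ne'
    rw [abs_of_pos hc] at this
    exact this.symm
  conv_rhs => rw [hv]
  rw [Measure.restrict_smul, lintegral_smul_measure, setLIntegral_map hs (measurable_gammaPDF _ _) hm,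
    smul_eq_mul]
  have hm' : Measurable fun x => gammaPDF a (r / c) (c * x) := (measurable_gammaPDF _ _).comp hm
  rw [← lintegral_const_mul _ hm']
  refine lintegral_congr fun x => ?_
  rw [gammaPDF, gammaPDF, ← ENNReal.ofReal_mul hc.le, mul_comm, gammaPDFReal_mul hr hc]

/-- The two exponentials merge, so only the rate changes, and the constant is the ratio of
normalizations. Since a change of rate is also a dilation (`map_mul_gammaMeasure`), tilting amounts
to rescaling. -/
theorem withDensity_exp_gammaMeasure {a r t : ℝ} (hr : 0 < r) (ht : t < r) :
    (gammaMeasure a r).withDensity (fun x => ENNReal.ofReal (Real.exp (t * x)))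
      = ENNReal.ofReal ((r / (r - t)) ^ a) • gammaMeasure a (r - t) := by
  have hrt : 0 < r - t := sub_pos.2 ht
  rw [gammaMeasure, gammaMeasure, ← withDensity_mul _ (measurable_gammaPDF a r) (by fun_prop),
    ← withDensity_smul _ (measurable_gammaPDF a (r - t))]
  congr 1
  ext x
  simp only [Pi.mul_apply, Pi.smul_apply, smul_eq_mul, gammaPDF]
  rw [← ENNReal.ofReal_mul' (Real.exp_pos _).le, ← ENNReal.ofReal_mul (by positivity)]
  congr 1
  unfold gammaPDFReal
  split_ifs with hx
  · have h2 : (r - t) ^ a ≠ 0 := (Real.rpow_pos_of_pos hrt a).ne'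
    have h3 : Real.exp (-(r * x)) * Real.exp (t * x) = Real.exp (-((r - t) * x)) := by
      rw [← Real.exp_add]; ring_nf
    rw [mul_assoc, h3, Real.div_rpow hr.le hrt.le]
    field_simp
  · simp

theorem lintegral_prod_pi {ι : Type*} [Fintype ι] {E : ι → Type*} [∀ i, MeasurableSpace (E i)]
    (μ : ∀ i, Measure (E i)) [∀ i, IsProbabilityMeasure (μ i)] {f : ∀ i, E i → ℝ≥0∞}
    (hf : ∀ i, Measurable (f i)) :
    ∫⁻ x, ∏ i, f i (x i) ∂Measure.pi μ = ∏ i, ∫⁻ x, f i x ∂μ i := by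
  rw [lintegral_prod_eq_prod_lintegral_of_indepFun Finset.univ (fun i (x : ∀ i, E i) => f i (x i))
    (iIndepFun_pi fun i => (hf i).aemeasurable)
    fun i => (hf i).comp (measurable_pi_apply i)]
  refine Finset.prod_congr rfl fun i _ => ?_
  exact (measurePreserving_eval μ i).lintegral_comp (hf i)

theorem pi_withDensity_prod {ι : Type*} [Fintype ι] {E : ι → Type*} [∀ i, MeasurableSpace (E i)]
    (μ : ∀ i, Measure (E i)) [∀ i, IsProbabilityMeasure (μ i)] {f : ∀ i, E i → ℝ≥0∞}
    (hf : ∀ i, Measurable (f i)) [∀ i, SigmaFinite ((μ i).withDensity (f i))] :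
    (Measure.pi μ).withDensity (fun x => ∏ i, f i (x i))
      = Measure.pi fun i => (μ i).withDensity (f i) := by
  refine (Measure.pi_eq fun s hs => ?_).symm
  rw [withDensity_apply _ (MeasurableSet.univ_pi hs), ← lintegral_indicator (MeasurableSet.univ_pi hs)]
  have h : ∀ x : ∀ i, E i, (Set.univ.pi s).indicator (fun x => ∏ i, f i (x i)) x
      = ∏ i, (s i).indicator (f i) (x i) := by
    intro x
    by_cases hx : x ∈ Set.univ.pi s
    · rw [Set.indicator_of_mem hx]
      exact Finset.prod_congr rfl fun i _ => (Set.indicator_of_mem (hx i trivial) _).symm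
    · rw [Set.indicator_of_notMem hx]
      obtain ⟨i, hi⟩ : ∃ i, x i ∉ s i := by simpa using hx
      exact (Finset.prod_eq_zero (Finset.mem_univ i) (Set.indicator_of_notMem hi _)).symm
  simp_rw [h]
  rw [lintegral_prod_pi μ fun i => (hf i).indicator (hs i)]
  refine Finset.prod_congr rfl fun i _ => ?_
  rw [lintegral_indicator (hs i), withDensity_apply _ (hs i)]

theorem pi_smul_measure {ι : Type*} [Fintype ι] {E : ι → Type*} [∀ i, MeasurableSpace (E i)]
    (μ : ∀ i, Measure (E i)) [∀ i, IsFiniteMeasure (μ i)] (c : ι → ℝ≥0∞) (hc : ∀ i, c i ≠ ∞) :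
    (Measure.pi fun i => c i • μ i) = (∏ i, c i) • Measure.pi μ := by
  have : ∀ i, IsFiniteMeasure (c i • μ i) := fun i => (μ i).smul_finite (hc i)
  refine Measure.pi_eq fun s _ => ?_
  simp [Measure.pi_pi, Finset.prod_mul_distrib]

/-! ### Independence of total and proportions for gamma vectors -/

section Gamma

variable {ι : Type*} [Fintype ι] {a : ι → ℝ} {r : ℝ}

/-- Exponential tilting of a product of gamma distributions amounts to a scaling. -/
theorem withDensity_exp_sum_pi_gammaMeasure (ha : ∀ i, 0 < a i) (hr : 0 < r) {t : ℝ} (ht : t < r) :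
    (Measure.pi fun i => gammaMeasure (a i) r).withDensity
        (fun y => ENNReal.ofReal (Real.exp (t * ∑ i, y i)))
      = ENNReal.ofReal ((r / (r - t)) ^ (∑ i, a i)) •
        (Measure.pi fun i => gammaMeasure (a i) r).map (fun y => (r / (r - t)) • y) := by
  have hrt : 0 < r - t := sub_pos.2 ht
  have hc : 0 < r / (r - t) := by positivity
  have h1 : ∀ i, IsProbabilityMeasure (gammaMeasure (a i) r) := fun i =>
    isProbabilityMeasure_gammaMeasure (ha i) hr
  have h2 : ∀ i, IsProbabilityMeasure (gammaMeasure (a i) (r - t)) := fun i =>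
    isProbabilityMeasure_gammaMeasure (ha i) hrt
  have h3 : ∀ y : ι → ℝ, ENNReal.ofReal (Real.exp (t * ∑ i, y i))
      = ∏ i, ENNReal.ofReal (Real.exp (t * y i)) := fun y => by
    rw [Finset.mul_sum, Real.exp_sum, ENNReal.ofReal_prod_of_nonneg fun i _ => (Real.exp_pos _).le]
  simp_rw [h3]
  have h4 := fun i => withDensity_exp_gammaMeasure (a := a i) hr ht
  have : ∀ i, IsFiniteMeasure ((gammaMeasure (a i) r).withDensity
      (fun x => ENNReal.ofReal (Real.exp (t * x)))) := fun i => by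
    rw [h4]; exact Measure.smul_finite _ ENNReal.ofReal_ne_top
  rw [pi_withDensity_prod (f := fun _ x => ENNReal.ofReal (Real.exp (t * x))) _
    fun i => by fun_prop]
  simp_rw [h4]
  rw [pi_smul_measure _ _ fun i => ENNReal.ofReal_ne_top,
    ← ENNReal.ofReal_prod_of_nonneg fun i _ => by positivity, ← Real.rpow_sum_of_pos hc]
  congr 1
  have h5 : ∀ i, (gammaMeasure (a i) r).map (fun x => r / (r - t) * x)
      = gammaMeasure (a i) (r - t) := fun i => by
    rw [map_mul_gammaMeasure hr hc, div_div_cancel₀ hr.ne']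
  have h6 : ∀ i, IsProbabilityMeasure
      ((gammaMeasure (a i) r).map (fun x => r / (r - t) * x)) := fun i => by
    rw [h5]; exact h2 i
  simp_rw [← h5]
  exact (Measure.pi_map_pi fun i => by fun_prop).symm

theorem lintegral_exp_mul_gammaMeasure {b t : ℝ} (hb : 0 < b) (hr : 0 < r) (ht : t < r) :
    ∫⁻ x, ENNReal.ofReal (Real.exp (t * x)) ∂gammaMeasure b r
      = ENNReal.ofReal ((r / (r - t)) ^ b) := by
  have := isProbabilityMeasure_gammaMeasure hb (sub_pos.2 ht)
  rw [← setLIntegral_univ, ← withDensity_apply _ MeasurableSet.univ,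
    withDensity_exp_gammaMeasure hr ht]
  simp

/-- For independent gamma variables with the same rate, the sum has a gamma distribution, and is
independent of every event that is invariant under scaling. -/
theorem map_sum_restrict_pi_gammaMeasure [Nonempty ι] (ha : ∀ i, 0 < a i) (hr : 0 < r)
    {G : Set (ι → ℝ)} (hG : MeasurableSet G)
    (hinv : ∀ c : ℝ, 0 < c → (fun y : ι → ℝ => c • y) ⁻¹' G = G) :
    ((Measure.pi fun i => gammaMeasure (a i) r).restrict G).map (fun y => ∑ i, y i)
      = (Measure.pi fun i => gammaMeasure (a i) r) G • gammaMeasure (∑ i, a i) r := by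
  set κ := Measure.pi fun i => gammaMeasure (a i) r with hκ
  have hA : 0 < ∑ i, a i := Finset.sum_pos (fun i _ => ha i) Finset.univ_nonempty
  have h1 : ∀ i, IsProbabilityMeasure (gammaMeasure (a i) r) := fun i =>
    isProbabilityMeasure_gammaMeasure (ha i) hr
  have h2 := isProbabilityMeasure_gammaMeasure hA hr
  have h3 : IsFiniteMeasure (κ G • gammaMeasure (∑ i, a i) r) :=
    Measure.smul_finite _ (measure_ne_top _ _)
  have hS : Measurable fun y : ι → ℝ => ∑ i, y i := by fun_prop
  set C : ℝ → ℝ≥0∞ := fun t => ENNReal.ofReal ((r / (r - t)) ^ (∑ i, a i))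
  -- The left side is the tilted mass of `G`; tilting dilates by `r / (r - t)`, which leaves `G`
  -- fixed.
  have e1 : ∀ t < r, ∫⁻ x, ENNReal.ofReal (Real.exp (t * x))
      ∂((κ.restrict G).map (fun y => ∑ i, y i)) = C t * κ G := by
    intro t ht
    have hc : 0 < r / (r - t) := div_pos hr (sub_pos.2 ht)
    rw [lintegral_map (by fun_prop) hS, ← withDensity_apply _ hG,
      withDensity_exp_sum_pi_gammaMeasure ha hr ht, Measure.smul_apply, smul_eq_mul,
      Measure.map_apply (by fun_prop) hG, hinv _ hc]
  have e2 : ∀ t < r, ∫⁻ x, ENNReal.ofReal (Real.exp (t * x))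
      ∂(κ G • gammaMeasure (∑ i, a i) r) = C t * κ G := by
    intro t ht
    rw [lintegral_smul_measure, lintegral_exp_mul_gammaMeasure hA hr ht, smul_eq_mul, mul_comm]
  have hint : ∀ {μ : Measure ℝ}, (∀ t < r, ∫⁻ x, ENNReal.ofReal (Real.exp (t * x)) ∂μ = C t * κ G) →
      0 ∈ interior (integrableExpSet id μ) := by
    intro μ h
    refine mem_interior_iff_mem_nhds.2 (mem_of_superset (Iio_mem_nhds hr) fun t ht => ?_)
    refine ⟨by fun_prop, ?_⟩
    rw [hasFiniteIntegral_iff_ofReal (ae_of_all _ fun x => (Real.exp_pos _).le)]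
    simp only [id_eq]
    rw [h t ht]
    exact ENNReal.mul_lt_top ENNReal.ofReal_lt_top (measure_lt_top _ _)
  refine measure_ext_of_mgf_eventuallyEq (hint e1) (hint e2) ?_
  filter_upwards [Iio_mem_nhds hr] with t ht
  simp only [mgf, id_eq]
  rw [integral_eq_lintegral_of_nonneg_ae (ae_of_all _ fun x => (Real.exp_pos _).le) (by fun_prop),
    integral_eq_lintegral_of_nonneg_ae (ae_of_all _ fun x => (Real.exp_pos _).le) (by fun_prop),
    e1 t ht, e2 t ht]

theorem map_sum_pi_gammaMeasure [Nonempty ι] (ha : ∀ i, 0 < a i) (hr : 0 < r) :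
    (Measure.pi fun i => gammaMeasure (a i) r).map (fun y => ∑ i, y i)
      = gammaMeasure (∑ i, a i) r := by
  have h1 : ∀ i, IsProbabilityMeasure (gammaMeasure (a i) r) := fun i =>
    isProbabilityMeasure_gammaMeasure (ha i) hr
  simpa using map_sum_restrict_pi_gammaMeasure ha hr MeasurableSet.univ fun _ _ => rfl

end Gamma

/-! ### Conditioning a mixture -/

section Kernel

variable {X Y E : Type*} [MeasurableSpace X] [MeasurableSpace Y] [MeasurableSpace E]

/-- This is Bayes' formula. A null event needs no exclusion: the density then vanishes almost
everywhere and both sides are the zero measure. -/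
theorem map_fst_cond_compProd (μ : Measure X) [SFinite μ] (κ : Kernel X Y) [IsSFiniteKernel κ]
    {C : Set Y} (hC : MeasurableSet C) :
    (cond (μ ⊗ₘ κ) (Prod.snd ⁻¹' C)).map Prod.fst
      = (∫⁻ x, κ x C ∂μ)⁻¹ • μ.withDensity fun x => κ x C := by
  ext s hs
  have h : Prod.snd ⁻¹' C ∩ Prod.fst ⁻¹' s = s ×ˢ C := by
    ext p; simp [and_comm]
  rw [Measure.map_apply measurable_fst hs, cond_apply (measurable_snd hC), h,
    Measure.compProd_apply_prod hs hC, Measure.smul_apply, withDensity_apply _ hs,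
    Measure.compProd_apply (measurable_snd hC)]
  rfl

/-- If `f` is independent of the event `C` under every law of a mixture, conditioning the mixture
on `C` only affects the mixing distribution. -/
theorem map_cond_comp (μ : Measure X) [SFinite μ] (κ κ' : Kernel X Y) [IsMarkovKernel κ]
    [IsSFiniteKernel κ'] {C : Set Y} (hC : MeasurableSet C) {f : Y → E} (hf : Measurable f)
    (h : ∀ x s, MeasurableSet s → κ x (C ∩ f ⁻¹' s) = κ' x C * κ x (f ⁻¹' s)) :
    (cond (κ ∘ₘ μ) C).map f
      = (κ.map f) ∘ₘ ((cond (μ ⊗ₘ κ') (Prod.snd ⁻¹' C)).map Prod.fst) := by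
  -- Both kernels give `C` the same mass, so the reweighting of `μ` may be computed with `κ'`; this
  -- lets the mixture weights be defined from another `α` with the same sum.
  have h1 : ∀ x, κ x C = κ' x C := fun x => by simpa using h x Set.univ MeasurableSet.univ
  rw [map_fst_cond_compProd μ κ' hC]
  ext s hs
  have hκ' : Measurable fun x => κ' x C := κ'.measurable_coe hC
  rw [Measure.map_apply hf hs, cond_apply hC, Measure.bind_apply hC κ.aemeasurable,
    Measure.bind_apply (hC.inter (hf hs)) κ.aemeasurable,
    Measure.bind_apply hs (κ.map f).aemeasurable, lintegral_smul_measure,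
    lintegral_withDensity_eq_lintegral_mul _ hκ' ((κ.map f).measurable_coe hs)]
  simp_rw [h1, h _ s hs, smul_eq_mul, Pi.mul_apply, Kernel.map_apply' κ hf _ hs]

end Kernel

/-! ### Part (i): from mixture weights to the conditional non-central Dirichlet law -/

theorem chiSqKernel_apply {D : ℕ} (α : Fin (D + 1) → ℝ) (n : Fin (D + 1) → ℕ) :
    chiSqKernel α n = Measure.pi fun i => gammaMeasure ((2 * α i + 2 * (n i : ℝ)) / 2) (1 / 2) :=
  rfl

theorem measurable_normalized {D : ℕ} : Measurable (normalized (D := D)) := by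
  unfold normalized
  fun_prop

theorem normalized_smul {D : ℕ} {c : ℝ} (hc : c ≠ 0) (y : Fin (D + 1) → ℝ) :
    normalized (c • y) = normalized y := by
  ext i
  simp only [normalized, Pi.smul_apply, smul_eq_mul, ← Finset.mul_sum]
  exact mul_div_mul_left _ _ hc

/-- The total of a vector with law `chiSqKernel α n` is independent of the normalized vector, and
its law depends on `α` only through `∑ i, α i`. -/
theorem chiSqKernel_sum_inter_normalized {D : ℕ} {α : Fin (D + 1) → ℝ} (hα : ∀ i, 0 < α i)
    (n : Fin (D + 1) → ℕ) {B : Set ℝ} (hB : MeasurableSet B) {s : Set (Fin D → ℝ)}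
    (hs : MeasurableSet s) :
    chiSqKernel α n ((fun y => ∑ i, y i) ⁻¹' B ∩ normalized ⁻¹' s)
      = gammaMeasure (∑ i, α i + ∑ i, (n i : ℝ)) (1 / 2) B
        * chiSqKernel α n (normalized ⁻¹' s) := by
  have hS : Measurable fun y : Fin (D + 1) → ℝ => ∑ i, y i := by fun_prop
  have hsum : ∑ i, (2 * α i + 2 * (n i : ℝ)) / 2 = ∑ i, α i + ∑ i, (n i : ℝ) := by
    rw [← Finset.sum_add_distrib]
    exact Finset.sum_congr rfl fun i _ => by ring
  have hs' := measurable_normalized hs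
  have h := map_sum_restrict_pi_gammaMeasure (a := fun i => (2 * α i + 2 * (n i : ℝ)) / 2)
    (r := 1 / 2) (fun i => by have := hα i; positivity) (by norm_num) hs'
    (fun c hc => by ext y; simp [normalized_smul hc.ne'])
  rw [hsum, ← chiSqKernel_apply] at h
  have h' := congrArg (fun ν : Measure ℝ => ν B) h
  simp only [Measure.smul_apply, smul_eq_mul] at h'
  rw [Measure.map_apply hS hB, Measure.restrict_apply (hS hB)] at h'
  rw [h', mul_comm]

theorem chiSqKernel_sum {D : ℕ} {α : Fin (D + 1) → ℝ} (hα : ∀ i, 0 < α i)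
    (n : Fin (D + 1) → ℕ) {B : Set ℝ} (hB : MeasurableSet B) :
    chiSqKernel α n ((fun y => ∑ i, y i) ⁻¹' B)
      = gammaMeasure (∑ i, α i + ∑ i, (n i : ℝ)) (1 / 2) B := by
  have := isMarkovKernel_chiSqKernel hα
  simpa using chiSqKernel_sum_inter_normalized hα n hB MeasurableSet.univ

theorem isProbabilityMeasure_ncChiSq {g : ℝ} (hg : 0 < g) (l : ℝ≥0) :
    IsProbabilityMeasure (ncChiSq g l) := by
  refine isProbabilityMeasure_bind (measurable_of_countable _).aemeasurable (ae_of_all _ fun m => ?_)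
  exact isProbabilityMeasure_chiSq (by positivity)

/-- The Poisson indices are independent, so by Tonelli a product of mixtures is a mixture of
products. -/
theorem pi_ncChiSq {D : ℕ} {α : Fin (D + 1) → ℝ} (hα : ∀ i, 0 < α i) (lam : Fin (D + 1) → ℝ≥0) :
    (Measure.pi fun i => ncChiSq (2 * α i) (lam i))
      = chiSqKernel α ∘ₘ (Measure.pi fun i => poissonMeasure (lam i / 2)) := by
  have hpos := fun i => mul_pos two_pos (hα i)
  have h1 : ∀ i, IsProbabilityMeasure (ncChiSq (2 * α i) (lam i)) := fun i =>
    isProbabilityMeasure_ncChiSq (hpos i) _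
  have h2 : ∀ i (m : ℕ), IsProbabilityMeasure (chiSq (2 * α i + 2 * (m : ℝ))) := fun i m =>
    isProbabilityMeasure_chiSq (by have := hpos i; positivity)
  refine Measure.pi_eq fun s hs => ?_
  rw [Measure.bind_apply (MeasurableSet.univ_pi hs) (chiSqKernel α).aemeasurable]
  have h3 : ∀ n, chiSqKernel α n (Set.univ.pi s) = ∏ i, chiSq (2 * α i + 2 * (n i : ℝ)) (s i) :=
    fun n => Measure.pi_pi _ _
  simp_rw [h3]
  rw [lintegral_prod_pi (fun i => poissonMeasure (lam i / 2))
    (f := fun i m => chiSq (2 * α i + 2 * (m : ℝ)) (s i)) fun i => measurable_of_countable _]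
  refine Finset.prod_congr rfl fun i _ => ?_
  rw [ncChiSq, Measure.bind_apply (hs i) (measurable_of_countable _).aemeasurable]

theorem map_normalized_cond_ncChiSq {D : ℕ} {α α' : Fin (D + 1) → ℝ} (hα : ∀ i, 0 < α i)
    (hα' : ∀ i, 0 < α' i) (hsum : ∑ i, α' i = ∑ i, α i) (lam : Fin (D + 1) → ℝ≥0) {B : Set ℝ}
    (hB : MeasurableSet B) :
    (cond (Measure.pi fun i => ncChiSq (2 * α i) (lam i)) ((fun y => ∑ k, y k) ⁻¹' B)).map
        normalized
      = ((chiSqKernel α).map normalized) ∘ₘ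
        ((cond (poissonChiSq α' lam) ((fun p => ∑ k, p.2 k) ⁻¹' B)).map Prod.fst) := by
  have := isMarkovKernel_chiSqKernel hα
  have := isMarkovKernel_chiSqKernel hα'
  have hS : Measurable fun y : Fin (D + 1) → ℝ => ∑ i, y i := by fun_prop
  rw [pi_ncChiSq hα]
  refine map_cond_comp _ (chiSqKernel α) (chiSqKernel α') (hS hB) measurable_normalized
    fun n s hs => ?_
  rw [chiSqKernel_sum_inter_normalized hα n hB hs, chiSqKernel_sum hα' n hB, hsum]

theorem IsMixtureWeight.isCNcDir {D : ℕ} {α : Fin (D + 1) → ℝ} (hα : ∀ i, 0 < α i)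
    {lam : Fin (D + 1) → ℝ≥0} {ν : Measure (Fin (D + 1) → ℕ)}
    (hν : IsMixtureWeight (∑ i, α i) lam ν) :
    IsCNcDir α lam (((chiSqKernel α).map normalized) ∘ₘ ν) := by
  obtain ⟨α', hα', hsum, hprob, hlim⟩ := hν
  have := isMarkovKernel_chiSqKernel hα
  have : IsMarkovKernel ((chiSqKernel α).map normalized) :=
    Kernel.IsMarkovKernel.map _ measurable_normalized
  refine ⟨inferInstance, fun f => ?_⟩
  -- The mixing space is discrete, so averaging `f` over the kernel gives a continuous bounded
  -- function, to which the weak limit defining `ν` applies.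
  set g : (Fin (D + 1) → ℕ) →ᵇ ℝ := BoundedContinuousFunction.ofNormedAddCommGroupDiscrete
    (fun n => ∫ x, f x ∂((chiSqKernel α).map normalized n)) ‖f‖ fun n => by
      simpa using f.norm_integral_le_norm ((chiSqKernel α).map normalized n)
  have key : ∀ ρ : Measure (Fin (D + 1) → ℕ), IsFiniteMeasure ρ →
      ∫ x, f x ∂(((chiSqKernel α).map normalized) ∘ₘ ρ) = ∫ n, g n ∂ρ := fun ρ _ => by
    have hf := f.integrable (((chiSqKernel α).map normalized) ∘ₘ ρ)
    rw [Measure.comp_eq_comp_const_apply] at hf ⊢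
    rw [Kernel.integral_comp hf, Kernel.const_apply]
    rfl
  rw [key ν inferInstance]
  refine (hlim g).congr fun ε => ?_
  rw [← key _ inferInstance,
    map_normalized_cond_ncChiSq hα hα' hsum lam Metric.isOpen_ball.measurableSet]

/-! ### Part (ii): extension of the space and the chi-squared model -/

/-- If `V` has the law of a function `T` on a probability space `(W, Q)`, the space carrying `V`
can be extended by a `W`-valued variable of law `Q` whose image under `T` is `V`. -/
theorem exists_kernel_lift {Ω : Type*} {W E : Type*} [MeasurableSpace Ω] [MeasurableSpace W]
    [StandardBorelSpace W] [Nonempty W] [MeasurableSpace E] {P : Measure Ω} [IsProbabilityMeasure P]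
    {Q : Measure W} [IsProbabilityMeasure Q] {V : Ω → E} (hV : AEMeasurable V P) {T : W → E}
    (h : P.map V = Q.map T) :
    ∃ κ : Kernel Ω W, IsMarkovKernel κ ∧
      (P ⊗ₘ κ).map (fun ω => (V ω.1, ω.2)) = Q.map fun w => (T w, w) := by
  -- The kernel is the conditional law of the model point given `T`, evaluated at a measurable
  -- version of `V`.
  refine ⟨(condDistrib id T Q).comap (hV.mk V) hV.measurable_mk, inferInstance, ?_⟩
  have hV' : (fun ω : Ω × W => (V ω.1, ω.2)) =ᵐ[P ⊗ₘ (condDistrib id T Q).comap (hV.mk V)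
      hV.measurable_mk] fun ω => (hV.mk V ω.1, ω.2) := by
    have hfst : MeasurePreserving Prod.fst (P ⊗ₘ (condDistrib id T Q).comap (hV.mk V)
      hV.measurable_mk) P := ⟨measurable_fst, Measure.fst_compProd _ _⟩
    filter_upwards [hfst.quasiMeasurePreserving.ae_eq_comp hV.ae_eq_mk] with ω hω
    exact Prod.ext hω rfl
  have hm := hV.measurable_mk
  have hQ : (Q.map T) ⊗ₘ condDistrib id T Q = Q.map fun w => (T w, w) :=
    compProd_map_condDistrib aemeasurable_id
  rw [Measure.map_congr hV', ← hQ, ← h, Measure.map_congr hV.ae_eq_mk]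
  ext s hs
  rw [Measure.map_apply (by fun_prop) hs,
    Measure.compProd_apply ((by fun_prop : Measurable fun ω : Ω × W => (hV.mk V ω.1, ω.2)) hs),
    Measure.compProd_apply hs, lintegral_map (Kernel.measurable_kernel_prodMk_left hs) hm]
  rfl

/-- Only finitely many coordinates enter, and their marginal is a finite product, so gamma
additivity applies. -/
theorem map_add_sum_infinitePi_gammaMeasure {r : ℝ} (hr : 0 < r)
    (b : Option ℕ → ℝ) (hb : ∀ k, 0 < b k) (m : ℕ) :
    (Measure.infinitePi fun k => gammaMeasure (b k) r).map
        (fun h => h none + ∑ j ∈ Finset.range m, h (some j))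
      = gammaMeasure (b none + ∑ j ∈ Finset.range m, b (some j)) r := by
  have h1 : ∀ k, IsProbabilityMeasure (gammaMeasure (b k) r) := fun k =>
    isProbabilityMeasure_gammaMeasure (hb k) hr
  set s := Finset.insertNone (Finset.range m)
  have : Nonempty s := ⟨⟨none, by simp [s]⟩⟩
  have h2 : ∀ h : Option ℕ → ℝ, h none + ∑ j ∈ Finset.range m, h (some j) = ∑ k : s, h k := by
    intro h
    rw [Finset.sum_coe_sort s h, Finset.sum_insertNone]
  have h3 : (fun h : Option ℕ → ℝ => ∑ k : s, h k)
      = (fun y : s → ℝ => ∑ k, y k) ∘ s.restrict := rfl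
  simp_rw [h2]
  rw [h3, ← Measure.map_map (by fun_prop) (by fun_prop), Measure.infinitePi_map_restrict,
    map_sum_pi_gammaMeasure (fun k : s => hb k) hr]

/-- The joint law of independent chi-squared variables indexed by `Option ℕ`: the variable of
index `none` has `g` degrees of freedom, the other ones have two. -/
noncomputable def chiSqBlock (g : ℝ) : Measure (Option ℕ → ℝ) :=
  Measure.infinitePi fun k => chiSq (k.elim g fun _ => 2)

theorem elim_two_pos {g : ℝ} (hg : 0 < g) (k : Option ℕ) : 0 < k.elim g fun _ => 2 := by
  cases k <;> simp [hg]

theorem isProbabilityMeasure_chiSqBlock {g : ℝ} (hg : 0 < g) :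
    IsProbabilityMeasure (chiSqBlock g) := by
  have : ∀ k : Option ℕ, IsProbabilityMeasure (chiSq (k.elim g fun _ => 2)) := fun k =>
    isProbabilityMeasure_chiSq (elim_two_pos hg k)
  unfold chiSqBlock
  infer_instance

theorem map_chiSqBlock {g : ℝ} (hg : 0 < g) (m : ℕ) :
    (chiSqBlock g).map (fun h => h none + ∑ j ∈ Finset.range m, h (some j))
      = chiSq (g + 2 * (m : ℝ)) := by
  have h := map_add_sum_infinitePi_gammaMeasure (r := 1 / 2) (by norm_num)
    (fun k => (k.elim g fun _ => 2) / 2) (fun k => half_pos (elim_two_pos hg k)) m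
  have e : g / 2 + (m : ℝ) = (g + 2 * m) / 2 := by ring
  simpa [chiSqBlock, chiSq, e] using h

section Representation

variable {D : ℕ}

/-- The vector of the sums of coordinates `none, 0, …, nᵢ - 1` of the `i`-th block. -/
def blockSum (n : Fin (D + 1) → ℕ) (w : Fin (D + 1) → Option ℕ → ℝ) : Fin (D + 1) → ℝ :=
  fun i => w i none + ∑ j ∈ Finset.range (n i), w i (some j)

theorem measurable_blockSum (n : Fin (D + 1) → ℕ) : Measurable (blockSum n) := by
  unfold blockSum
  fun_prop

theorem measurable_blockSum_uncurry :
    Measurable fun q : (Fin (D + 1) → ℕ) × (Fin (D + 1) → Option ℕ → ℝ) => blockSum q.1 q.2 :=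
  measurable_from_prod_countable_right measurable_blockSum

theorem map_blockSum {α : Fin (D + 1) → ℝ} (hα : ∀ i, 0 < α i) (n : Fin (D + 1) → ℕ) :
    (Measure.infinitePi fun i => chiSqBlock (2 * α i)).map (blockSum n) = chiSqKernel α n := by
  have hpos := fun i => mul_pos two_pos (hα i)
  have h1 : ∀ i, IsProbabilityMeasure (chiSqBlock (2 * α i)) := fun i =>
    isProbabilityMeasure_chiSqBlock (hpos i)
  have h2 : ∀ i, IsProbabilityMeasure (chiSq (2 * α i + 2 * (n i : ℝ))) := fun i =>
    isProbabilityMeasure_chiSq (by have := hpos i; positivity)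
  have h3 := Measure.infinitePi_map_pi (fun i => chiSqBlock (2 * α i))
    (f := fun i h => h none + ∑ j ∈ Finset.range (n i), h (some j)) fun i => by fun_prop
  simp_rw [map_chiSqBlock (hpos _)] at h3
  exact h3.trans (Measure.infinitePi_eq_pi _)

theorem map_prod_blockSum {α : Fin (D + 1) → ℝ} (hα : ∀ i, 0 < α i)
    (ν : Measure (Fin (D + 1) → ℕ)) [IsProbabilityMeasure ν] :
    (ν.prod (Measure.infinitePi fun i => chiSqBlock (2 * α i))).map
        (fun q => (q.1, blockSum q.1 q.2)) = ν ⊗ₘ chiSqKernel α := by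
  have h1 : ∀ i, IsProbabilityMeasure (chiSqBlock (2 * α i)) := fun i =>
    isProbabilityMeasure_chiSqBlock (mul_pos two_pos (hα i))
  have := isMarkovKernel_chiSqKernel hα
  have hm : Measurable fun q : (Fin (D + 1) → ℕ) × (Fin (D + 1) → Option ℕ → ℝ) =>
      (q.1, blockSum q.1 q.2) := measurable_fst.prodMk measurable_blockSum_uncurry
  ext s hs
  rw [Measure.map_apply hm hs, Measure.prod_apply (hm hs), Measure.compProd_apply hs]
  refine lintegral_congr fun n => ?_
  rw [← map_blockSum hα n, Measure.map_apply (measurable_blockSum n) (measurable_prodMk_left hs)]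
  rfl

theorem iIndepFun_infinitePi_chiSqBlock {α : Fin (D + 1) → ℝ} (hα : ∀ i, 0 < α i) :
    iIndepFun (fun (p : Fin (D + 1) × Option ℕ) (w : Fin (D + 1) → Option ℕ → ℝ) => w p.1 p.2)
      (Measure.infinitePi fun i => chiSqBlock (2 * α i)) := by
  have : ∀ i (k : Option ℕ), IsProbabilityMeasure (chiSq (k.elim (2 * α i) fun _ => 2)) :=
    fun i k => isProbabilityMeasure_chiSq (elim_two_pos (mul_pos two_pos (hα i)) k)
  exact iIndepFun_uncurry_infinitePi' (X := fun _ _ x => x)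
    (fun i (k : Option ℕ) => chiSq (k.elim (2 * α i) fun _ => 2)) fun _ _ => measurable_id

theorem hasLaw_infinitePi_chiSqBlock {α : Fin (D + 1) → ℝ} (hα : ∀ i, 0 < α i)
    (i : Fin (D + 1)) (k : Option ℕ) :
    HasLaw (fun w : Fin (D + 1) → Option ℕ → ℝ => w i k) (chiSq (k.elim (2 * α i) fun _ => 2))
      (Measure.infinitePi fun i => chiSqBlock (2 * α i)) := by
  have h1 : ∀ i, IsProbabilityMeasure (chiSqBlock (2 * α i)) := fun i =>
    isProbabilityMeasure_chiSqBlock (mul_pos two_pos (hα i))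
  have : ∀ k : Option ℕ, IsProbabilityMeasure (chiSq (k.elim (2 * α i) fun _ => 2)) := fun k =>
    isProbabilityMeasure_chiSq (elim_two_pos (mul_pos two_pos (hα i)) k)
  exact ((measurePreserving_eval_infinitePi
    (fun k : Option ℕ => chiSq (k.elim (2 * α i) fun _ => 2)) k).comp
      (measurePreserving_eval_infinitePi (fun i => chiSqBlock (2 * α i)) i)).hasLaw

end Representation

/-- Independence is a property of the joint law, which `f` preserves. -/
theorem iIndepFun_comp_of_measurePreserving {ι Ω W : Type*} {E : ι → Type*} [MeasurableSpace Ω]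
    [MeasurableSpace W] [∀ i, MeasurableSpace (E i)] {P : Measure Ω} {Q : Measure W}
    [IsProbabilityMeasure P] [IsProbabilityMeasure Q] {f : Ω → W} (hf : MeasurePreserving f P Q)
    {X : ∀ i, W → E i} (hX : ∀ i, Measurable (X i)) (h : iIndepFun X Q) :
    iIndepFun (fun i ω => X i (f ω)) P := by
  have hX' : Measurable fun w i => X i w := measurable_pi_lambda _ hX
  have hm := hf.measurable
  have e1 : ∀ i, P.map (fun ω => X i (f ω)) = Q.map (X i) := fun i => by
    rw [← hf.map_eq, Measure.map_map (hX i) hm]; rfl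
  refine (iIndepFun_iff_map_fun_eq_infinitePi_map fun i => (hX i).comp hm).2 ?_
  simp_rw [Function.comp_def, e1]
  rw [← (iIndepFun_iff_map_fun_eq_infinitePi_map hX).1 h, ← hf.map_eq, Measure.map_map hX' hm]
  rfl

/-! ### Assembly of both parts -/

theorem mainTheorem11 {D : ℕ} (α : Fin (D + 1) → ℝ) (hα : ∀ i, 0 < α i)
    (lam : Fin (D + 1) → ℝ≥0)
    {Ω : Type u} [MeasurableSpace Ω] (P : Measure Ω) [IsProbabilityMeasure P]
    (N : Ω → Fin (D + 1) → ℕ) (Z' : Ω → Fin (D + 1) → ℝ)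
    (hN : IsMixtureWeight (∑ i, α i) lam (P.map N))
    (hZ' : HasCondDistrib Z' N (chiSqKernel α) P) :
    -- (i) the normalized vector has the conditional non-central Dirichlet distribution
    IsCNcDir α lam (P.map fun ω => normalized (Z' ω)) ∧
    -- (ii) on an extension `π : Ω' → Ω` of the probability space, each `Z'ᵢ` is the sum of `Zᵢ`
    -- and of `Nᵢ` chi-squared variables, all the ingredients being mutually independent
    ∃ (Ω' : Type u) (_ : MeasurableSpace Ω') (P' : Measure Ω') (π : Ω' → Ω)
      (Z : Fin (D + 1) → Ω' → ℝ) (F : Fin (D + 1) × ℕ → Ω' → ℝ),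
      IsProbabilityMeasure P' ∧ MeasurePreserving π P' P ∧
      (∀ i, HasLaw (Z i) (chiSq (2 * α i)) P') ∧
      (∀ k, HasLaw (F k) (chiSq 2) P') ∧
      iIndepFun (Sum.elim Z F) P' ∧
      IndepFun (fun ω => N (π ω)) (fun ω k => Sum.elim Z F k ω) P' ∧
      ∀ᵐ ω ∂P', ∀ i, Z' (π ω) i = Z i ω + ∑ j ∈ Finset.range (N (π ω) i), F (i, j) ω := by
  have := isMarkovKernel_chiSqKernel hα
  have hNm : AEMeasurable N P := hZ'.aemeasurable_fst
  have hZm : AEMeasurable Z' P := hZ'.aemeasurable_snd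
  constructor
  · have h1 := hZ'.comp_left measurable_normalized
    have h2 : P.map (fun ω => normalized (Z' ω))
        = ((chiSqKernel α).map normalized) ∘ₘ (P.map N) := by
      have : IsMarkovKernel ((chiSqKernel α).map normalized) :=
        Kernel.IsMarkovKernel.map _ measurable_normalized
      have h3 := congrArg Measure.snd h1.map_eq
      rwa [Measure.snd_compProd, Measure.snd_map_prodMk₀ hNm] at h3
    rw [h2]
    exact hN.isCNcDir hα
  · have hblock : ∀ i, IsProbabilityMeasure (chiSqBlock (2 * α i)) := fun i =>
      isProbabilityMeasure_chiSqBlock (mul_pos two_pos (hα i))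
    have : IsProbabilityMeasure (P.map N) := Measure.isProbabilityMeasure_map hNm
    set G : Measure (Fin (D + 1) → Option ℕ → ℝ) :=
      Measure.infinitePi fun i => chiSqBlock (2 * α i)
    have hT : Measurable fun q : (Fin (D + 1) → ℕ) × (Fin (D + 1) → Option ℕ → ℝ) =>
      (q.1, blockSum q.1 q.2) := measurable_fst.prodMk measurable_blockSum_uncurry
    obtain ⟨κ, hκ, hlaw⟩ := exists_kernel_lift (Q := (P.map N).prod G) hZ'.aemeasurable
      (hZ'.map_eq.trans (map_prod_blockSum hα (P.map N)).symm)
    have hfst : MeasurePreserving Prod.fst (P ⊗ₘ κ) P := ⟨measurable_fst, Measure.fst_compProd P κ⟩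
    have hNm' : AEMeasurable (fun ω => N (Prod.fst ω)) (P ⊗ₘ κ) :=
      hNm.comp_quasiMeasurePreserving hfst.quasiMeasurePreserving
    have hZm' : AEMeasurable (fun ω => Z' (Prod.fst ω)) (P ⊗ₘ κ) :=
      hZm.comp_quasiMeasurePreserving hfst.quasiMeasurePreserving
    set Y : Ω × ((Fin (D + 1) → ℕ) × (Fin (D + 1) → Option ℕ → ℝ)) → _ := fun ω => ω.2.2
    have hlaw2 : (P ⊗ₘ κ).map Prod.snd = (P.map N).prod G := by
      have h3 := congrArg Measure.snd hlaw
      rw [Measure.snd_map_prodMk₀ (hNm'.prodMk hZm'), Measure.snd_map_prodMk hT] at h3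
      simpa using h3
    have hY : MeasurePreserving Y (P ⊗ₘ κ) G := by
      refine measurePreserving_snd.comp (μb := (P.map N).prod G) ⟨measurable_snd, hlaw2⟩
    -- The relation holds everywhere in the model and defines a measurable event, so it passes
    -- through the equality of laws `hlaw`.
    have hae : ∀ᵐ ω ∂(P ⊗ₘ κ), N ω.1 = ω.2.1 ∧ Z' ω.1 = blockSum ω.2.1 ω.2.2 := by
      have hset : MeasurableSet {x : ((Fin (D + 1) → ℕ) × (Fin (D + 1) → ℝ)) ×
          ((Fin (D + 1) → ℕ) × (Fin (D + 1) → Option ℕ → ℝ)) |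
          x.1 = (x.2.1, blockSum x.2.1 x.2.2)} :=
        measurableSet_eq_fun measurable_fst (hT.comp measurable_snd)
      have h3 : ∀ᵐ x ∂((P.map N).prod G).map fun q => ((q.1, blockSum q.1 q.2), q),
          x.1 = (x.2.1, blockSum x.2.1 x.2.2) := by
        exact (ae_map_iff (hT.prodMk measurable_id').aemeasurable hset).2
          (ae_of_all _ fun q => rfl)
      rw [← hlaw, ae_map_iff ((hNm'.prodMk hZm').prodMk measurable_snd.aemeasurable) hset] at h3
      filter_upwards [h3] with ω hω
      exact Prod.ext_iff.1 hω
    -- All `Z` and `F` are coordinates of `Y` under an injective reindexing (`none` for `Z`), so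
    -- they inherit its independence.
    have hSum : Sum.elim (fun i ω => Y ω i none)
        (fun (p : Fin (D + 1) × ℕ) ω => Y ω p.1 (some p.2))
        = fun k ω => Y ω (k.elim (fun i => (i, none)) fun p => (p.1, some p.2)).1
            (k.elim (fun i => (i, none)) fun p => (p.1, some p.2)).2 := by
      funext k
      cases k <;> rfl
    refine ⟨_, inferInstance, P ⊗ₘ κ, Prod.fst, fun i ω => Y ω i none,
      fun p ω => Y ω p.1 (some p.2), inferInstance, hfst,
      fun i => (hasLaw_infinitePi_chiSqBlock hα i none).comp hY.hasLaw,
      fun p => (hasLaw_infinitePi_chiSqBlock hα p.1 (some p.2)).comp hY.hasLaw, ?_, ?_, ?_⟩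
    · rw [hSum]
      have hinj : Function.Injective fun k : Fin (D + 1) ⊕ Fin (D + 1) × ℕ =>
          (k.elim (fun i => (i, none)) fun p => (p.1, some p.2) : Fin (D + 1) × Option ℕ) := by
        rintro (i | ⟨i, j⟩) (i' | ⟨i', j'⟩) h <;> simp_all
      exact (iIndepFun_comp_of_measurePreserving hY (fun _ => by fun_prop)
        (iIndepFun_infinitePi_chiSqBlock hα)).precomp hinj
    · have hind : IndepFun (fun ω => N ω.1) Y (P ⊗ₘ κ) := by
        -- Independence is clear for the model's own copy of `N`, which agrees with `N` almost
        -- surely.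
        have h3 : IndepFun (fun ω => ω.2.1) Y (P ⊗ₘ κ) := by
          rw [indepFun_iff_map_prod_eq_prod_map_map (by fun_prop) hY.measurable.aemeasurable,
            hY.map_eq]
          have h4 : (P ⊗ₘ κ).map (fun ω => ω.2.1) = P.map N := by
            have h5 := congrArg Measure.fst hlaw2
            rw [Measure.fst_prod, Measure.fst, Measure.map_map measurable_fst measurable_snd] at h5
            exact h5
          rw [h4]
          exact hlaw2
        refine h3.congr ?_ Filter.EventuallyEq.rfl
        filter_upwards [hae] with ω hω using hω.1.symm
      rw [hSum]
      exact hind.comp (φ := id) (ψ := fun w (k : Fin (D + 1) ⊕ Fin (D + 1) × ℕ) =>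
        w (k.elim (fun i => (i, none)) fun p => (p.1, some p.2)).1
          (k.elim (fun i => (i, none)) fun p => (p.1, some p.2)).2) measurable_id (by fun_prop)
    · filter_upwards [hae] with ω hω i
      rw [hω.2, hω.1]
      rfl
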